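/- Consider the scalar system $x_{i+1}=a^*x_i+b^*u_i+w_i$ with $\theta^*=(a^*,b^*)\in\Theta=[\underline a,\bar a]\times[\underline b,\bar b]$, $\underline a,\underline b>0$, where the $w_i$ are i.i.d. from a fixed sub-Gaussian distribution $\mathcal D$ with mean $0$, variance $1$ and bounded density. Let $q,r>0$, and let the safety boundaries satisfy $D_L<0<D_U$, $|D_L|,|D_U|\le B$ for a constant $B$, and $D_U-D_L\ge 1/\log T$. For $\theta=(a,b)$ and $K\in[\frac{a-1}{b},\frac ab]$ the truncated linear controller is $$C_K^\theta(x)=\begin{cases}-Kx & D_L\le (a-bK)x\le D_U,\\ (D_U-ax)/b & (a-bK)x>D_U,\\ (D_L-ax)/b & (a-bK)x<D_L.\end{cases}$$ For a controller $C$, a starting state $x_0=x$ and noise $W'=(w_0,\dots,w_{t-1})$, the realized average cost under $\theta^*$ is $J(\theta^*,C,t,x,W')=\frac1t\bigl(qx_t^2+\sum_{i=0}^{t-1}(qx_i^2+ru_i^2)\bigr)$ with $u_i=C(x_i)$ (and $tJ:=0$ for $t=0$). **Lemma.** There are constants $k\in\mathbb N$, $M\in\mathbb R$ and $T_0$ and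 a function $\rho(T)=o(1/T^{10})$, depending only on $q,r,\mathcal D,\Theta,B$, such that the following holds for every $T\ge T_0$ and all $D_L,D_U,\theta^*$ as above. For every $t<T$, every $\theta=(a,b)$ with $\|\theta-\theta^*\|_\infty\le 1/\log^{46}T$ and every $K\in[\frac{a-1}{b},\frac ab]$ there is a measurable set $\mathcal Y\subseteq\mathbb R^t$, which for the given $T,t,D_L,D_U,\theta^*$ depends only on the controller $C_K^\theta$, such that $\mathbb P(W'\in\mathcal Y)\ge 1-\rho(T)$ and, whenever $W'\in\mathcal Y$, for all $x,y$ with $|x|,|y|\le 4\log^2T$ and $|x-y|\le 1/\log^{10}T$, $$\bigl|\,t\,J(\theta^*,C_K^\theta,t,x,W')-t\,J(\theta^*,C_K^\theta,t,y,W')\,\bigr|\le M\log^k(T)\,\bigl(|x-y|+\|\theta-\theta^*\|_\infty\bigr).$$ -/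

import Mathlib

open MeasureTheory ProbabilityTheory Filter Asymptotics

/-- The noise distribution: a sub-Gaussian probability law on `ℝ` with mean `0`, variance `1`
and a bounded probability density. -/
structure IsNoiseDistribution (μ : Measure ℝ) : Prop where
  isProbabilityMeasure : IsProbabilityMeasure μ
  mean_zero : ∫ z, z ∂μ = 0
  variance_one : Var[fun z : ℝ => z; μ] = 1
  bounded_density : ∃ f : ℝ → ENNReal, Measurable f ∧ μ = volume.withDensity f ∧
    ∃ B : NNReal, ∀ z, f z ≤ B
  subgaussian : ∃ α : NNReal, HasSubgaussianMGF (fun z : ℝ => z) α μ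

/-- The law of `t` i.i.d. noise variables `w₀, …, w_{t-1}` with common law `μ`. -/
noncomputable def noiseLaw (μ : Measure ℝ) (t : ℕ) : Measure (Fin t → ℝ) :=
  Measure.pi fun _ => μ

/-- The standing assumption on the expected-state safety boundaries for horizon `T`;
`B` is the constant in `D_L, D_U = O_T(1)`. -/
structure IsSafetyBoundary (B : ℝ) (T : ℕ) (DL DU : ℝ) : Prop where
  lower_neg : DL < 0
  upper_pos : 0 < DU
  abs_lower_le : |DL| ≤ B
  abs_upper_le : |DU| ≤ B
  gap : 1 / Real.log T ≤ DU - DL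

/-- The truncated linear controller `C_K^θ` for dynamics `θ = (a, b)` and boundaries
`DL`, `DU`. -/
noncomputable def truncatedLinear (DL DU : ℝ) (θ : ℝ × ℝ) (K : ℝ) : ℝ → ℝ := fun x =>
  if DU < (θ.1 - θ.2 * K) * x then (DU - θ.1 * x) / θ.2
  else if (θ.1 - θ.2 * K) * x < DL then (DL - θ.1 * x) / θ.2
  else -K * x

/-- The state `x_i` (for `i ≤ t`) under dynamics `θ = (a, b)`, state-feedback controller `C`,
starting state `x₀` and noise `w₀, …, w_{t-1}`: `x_{i+1} = a x_i + b C(x_i) + w_i`.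
(States with index `i > t` are continued without noise and are never used.) -/
noncomputable def state (θ : ℝ × ℝ) (C : ℝ → ℝ) {t : ℕ} (x₀ : ℝ) (w : Fin t → ℝ) : ℕ → ℝ
  | 0 => x₀
  | i + 1 => θ.1 * state θ C x₀ w i + θ.2 * C (state θ C x₀ w i) +
      (if h : i < t then w ⟨i, h⟩ else 0)

/-- The realized average cost `J(θ, C, t, x₀, w)` over `t` steps, with weights `q`, `r`. -/
noncomputable def avgCost (q r : ℝ) (θ : ℝ × ℝ) (C : ℝ → ℝ) (t : ℕ) (x₀ : ℝ)
    (w : Fin t → ℝ) : ℝ :=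
  (1 / (t : ℝ)) * (q * state θ C x₀ w t ^ 2 +
    ∑ i ∈ Finset.range t, (q * state θ C x₀ w i ^ 2 + r * C (state θ C x₀ w i) ^ 2))

/-! Under `θstar` the controller gives `x ↦ β · truncate (c x) + η x + w`, where `c = a - bK` lies
in `[0, 1]`, `β = b*/b` is close to `1` and `η = a* - (b*/b) a` is close to `0`. Run two
trajectories with the same noise; the total cost difference is at most a multiple of `R` times the
sum of the distances `|X i - Y i|`, where `R = 4 log² T` bounds all states
(`abs_mul_avgCost_sub_le`). It remains to bound that sum by `O(log T) |x - y|`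
(`sum_abs_sub_le_of_closedLoop`).

If `c ≤ 1 - κ` for a fixed `κ`, the map is a contraction and the sum is geometric. If `c` is near
`1`, the map may expand slightly, but wherever both states lie above the upper threshold it has
slope `η`, so the distance almost vanishes. A run of `m` noise values above a fixed `σ > 0` lifts
every state above that threshold (`lt_of_push`), with `m` constant because the thresholds are
bounded. Each block of length `m` is such a run with constant probability, so outside an event of
probability `O(T⁻¹²)` every window of `O(log T)` blocks contains one
(`noiseLaw_real_not_isRegularNoise_le_div`). Over one window the expansion is at most a factor `2`,
hence the distance halves from window to window.

The resulting bound is of order `log³ T · |x - y|`, which is stronger than required: the term `‖θ -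
θstar‖` is added only at the end. -/

/-- The noise sequence extended by zero past the horizon. -/
noncomputable def extendNoise {t : ℕ} (w : Fin t → ℝ) (i : ℕ) : ℝ :=
  if h : i < t then w ⟨i, h⟩ else 0

/-! ### Noise: tails and runs of large values -/

/-- A noise distribution charges some half-line `[σ, ∞)` with `σ > 0`. -/
lemma IsNoiseDistribution.exists_pos_real_Ici {μ : Measure ℝ} (hμ : IsNoiseDistribution μ) :
    ∃ σ : ℝ, 0 < σ ∧ 0 < μ.real (Set.Ici σ) := by
  have := hμ.isProbabilityMeasure
  obtain ⟨α, hα⟩ := hμ.subgaussian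
  by_contra! hcon
  have hnull : μ (Set.Ioi 0) = 0 := by
    have hU : Set.Ioi (0 : ℝ) = ⋃ n : ℕ, Set.Ici (1 / ((n : ℝ) + 1)) := by
      ext z
      simp only [Set.mem_Ioi, Set.mem_iUnion, Set.mem_Ici]
      refine ⟨fun hz => ?_, fun ⟨n, hn⟩ => lt_of_lt_of_le (by positivity) hn⟩
      obtain ⟨n, hn⟩ := exists_nat_one_div_lt hz
      exact ⟨n, hn.le⟩
    rw [hU, measure_iUnion_null_iff]
    intro n
    have h := hcon (1 / ((n : ℝ) + 1)) (by positivity)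
    exact (measureReal_eq_zero_iff).1 (le_antisymm h measureReal_nonneg)
  -- A nonpositive variable with mean zero vanishes almost surely, contradicting variance one.
  have hle : ∀ᵐ z ∂μ, 0 ≤ -z := by
    have : ∀ᵐ z ∂μ, z ∉ Set.Ioi (0 : ℝ) := measure_eq_zero_iff_ae_notMem.1 hnull
    filter_upwards [this] with z hz
    simpa using hz
  have hint : Integrable (fun z : ℝ => z) μ := hα.integrable
  have hzero : (fun z : ℝ => -z) =ᵐ[μ] 0 := by
    rw [← integral_eq_zero_iff_of_nonneg_ae hle hint.neg]
    rw [integral_neg, hμ.mean_zero, neg_zero]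
  have hzero' : (fun z : ℝ => z) =ᵐ[μ] fun _ => 0 := by
    filter_upwards [hzero] with z hz
    simpa using hz
  have h1 := hμ.variance_one
  rw [variance_congr hzero'] at h1
  exact zero_ne_one ((variance_zero μ).symm.trans h1)

/-- Exponential two-sided tail of a sub-Gaussian law, at a fixed rate `s`. -/
lemma HasSubgaussianMGF.real_abs_gt_le {μ : Measure ℝ} [IsProbabilityMeasure μ] {α : NNReal}
    (hα : HasSubgaussianMGF (fun z : ℝ => z) α μ) {s : ℝ} (hs : 0 ≤ s) (x : ℝ) :
    μ.real {z | x < |z|} ≤ 2 * Real.exp (α * s ^ 2 / 2) * Real.exp (-s * x) := by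
  have h1 := (measure_ge_le_exp_mul_mgf x hs (hα.integrable_exp_mul s)).trans
    (mul_le_mul_of_nonneg_left (hα.mgf_le s) (Real.exp_pos _).le)
  have h2 := (measure_le_le_exp_mul_mgf (-x) (neg_nonpos.2 hs) (hα.integrable_exp_mul (-s))).trans
    (mul_le_mul_of_nonneg_left (hα.mgf_le (-s)) (Real.exp_pos _).le)
  have hsub : {z : ℝ | x < |z|} ⊆ {z | x ≤ z} ∪ {z | z ≤ -x} := by
    intro z hz
    rcases lt_abs.1 (show x < |z| from hz) with h | h
    · exact Or.inl h.le
    · exact Or.inr (show z ≤ -x by linarith)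
  calc μ.real {z | x < |z|} ≤ μ.real ({z | x ≤ z} ∪ {z | z ≤ -x}) := measureReal_mono hsub
    _ ≤ _ := measureReal_union_le _ _
    _ ≤ _ := add_le_add h1 h2
    _ = _ := by
      rw [neg_neg, neg_sq, mul_neg, neg_mul]; ring

/-- Among `L` disjoint blocks of `m` independent variables, the probability that no block lies
entirely in `S`. -/
lemma pi_real_no_block {μ : Measure ℝ} [IsProbabilityMeasure μ] {t L m : ℕ}
    {g : Fin L × Fin m → Fin t} (hg : Function.Injective g) {S : Set ℝ} (hS : MeasurableSet S) :
    (Measure.pi fun _ : Fin t => μ).real {w | ∀ l, ∃ i, w (g (l, i)) ∉ S} =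
      (1 - μ.real S ^ m) ^ L := by
  classical
  set P := Measure.pi fun _ : Fin t => μ with hP
  let I : Fin L → Finset (Fin t) := fun l => Finset.univ.image fun i => g (l, i)
  let E : Fin L → Set (Fin t → ℝ) := fun l => (I l : Set (Fin t)).pi fun _ => S
  have hI : ∀ l, (I l).card = m := fun l => by
    rw [Finset.card_image_of_injective _ fun i j h => by simpa using hg h]; simp
  have hdisj : ∀ l l', l ≠ l' → Disjoint (I l) (I l') := by
    intro l l' hl
    rw [Finset.disjoint_left]
    intro a ha ha'
    obtain ⟨i, -, rfl⟩ := Finset.mem_image.1 ha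
    obtain ⟨j, -, hj⟩ := Finset.mem_image.1 ha'
    exact hl (congrArg Prod.fst (hg hj)).symm
  have hEm : ∀ l, MeasurableSet (E l) := fun l =>
    MeasurableSet.pi (Finset.countable_toSet _) fun _ _ => hS
  have hE : ∀ l, P (E l) = μ S ^ m := fun l => by
    rw [hP, Measure.pi_pi_finset, Finset.prod_const, hI]
  have hind : iIndepSet E P := by
    rw [iIndepSet_iff_meas_biInter hEm]
    intro s
    -- An intersection of block events is again a cylinder, over the disjoint union of the blocks,
    -- so its measure is a product.
    have : ⋂ l ∈ s, E l = ((s.biUnion I : Finset (Fin t)) : Set (Fin t)).pi fun _ => S := by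
      ext w
      simp only [E, Set.mem_iInter, Set.mem_pi, Finset.mem_coe, Finset.mem_biUnion]
      exact ⟨fun h a ⟨l, hl, ha⟩ => h l hl a ha, fun h l hl a ha => h a ⟨l, hl, ha⟩⟩
    rw [this, hP, Measure.pi_pi_finset, Finset.prod_const,
      Finset.card_biUnion fun l _ l' _ h => hdisj l l' h, ← hP]
    simp only [hI, hE, Finset.prod_const, Finset.sum_const, smul_eq_mul, ← pow_mul, mul_comm]
  have hset : {w : Fin t → ℝ | ∀ l, ∃ i, w (g (l, i)) ∉ S} = ⋂ l, (E l)ᶜ := by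
    ext w
    simp [E, I, Set.mem_pi]
  have hmeas : P (⋂ l, (E l)ᶜ) = ∏ l, P (E l)ᶜ :=
    ((iIndepSet_iff_iIndep E P).1 hind).meas_iInter fun l =>
      (MeasurableSpace.measurableSet_generateFrom (Set.mem_singleton _)).compl
  have hcompl : ∀ l, P.real (E l)ᶜ = 1 - μ.real S ^ m := fun l => by
    rw [probReal_compl_eq_one_sub (hEm l), measureReal_def, hE, ENNReal.toReal_pow, measureReal_def]
  rw [hset, measureReal_def, hmeas, ENNReal.toReal_prod]
  simp only [← measureReal_def, hcompl, Finset.prod_const, Finset.card_univ, Fintype.card_fin]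

/-- The noise is bounded by `ℓ`, and any `L` consecutive blocks of length `m` contain one
in which the noise stays above `σ`. -/
def IsRegularNoise (ℓ σ : ℝ) (L m : ℕ) {t : ℕ} (w : Fin t → ℝ) : Prop :=
  (∀ i, |w i| ≤ ℓ) ∧
    ∀ s, s + L * m ≤ t → ∃ l < L, ∀ i < m, σ ≤ extendNoise w (s + l * m + i)

/-- Union bound over the `t` coordinates and the `t + 1` window starts `s`; within one window the
blocks are disjoint, hence independent. -/
lemma noiseLaw_real_not_isRegularNoise_le {μ : Measure ℝ} [IsProbabilityMeasure μ]
    (ℓ σ : ℝ) (L m t : ℕ) :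
    (noiseLaw μ t).real {w | ¬ IsRegularNoise ℓ σ L m w} ≤
      t * μ.real {z | ℓ < |z|} + (t + 1) * (1 - μ.real (Set.Ici σ) ^ m) ^ L := by
  classical
  have : IsProbabilityMeasure (noiseLaw μ t) := by unfold noiseLaw; infer_instance
  have hsub : {w : Fin t → ℝ | ¬ IsRegularNoise ℓ σ L m w} ⊆
      (⋃ i ∈ (Finset.univ : Finset (Fin t)), {w : Fin t → ℝ | ℓ < |w i|}) ∪
      ⋃ s ∈ Finset.range (t + 1), {w : Fin t → ℝ | s + L * m ≤ t ∧
        ∀ l < L, ∃ i < m, extendNoise w (s + l * m + i) < σ} := by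
    intro w hw
    by_contra hcon
    simp only [Set.mem_union, Set.mem_iUnion, not_or, Set.mem_ofPred_eq, not_exists,
      Finset.mem_univ, Finset.mem_range] at hcon
    refine hw ⟨fun i => not_lt.1 (hcon.1 i trivial), fun s hs => ?_⟩
    have h := hcon.2 s (by omega)
    push Not at h
    exact h hs
  refine (measureReal_mono hsub).trans ((measureReal_union_le _ _).trans (add_le_add ?_ ?_))
  · refine (measureReal_biUnion_finset_le _ _).trans ?_
    have : ∀ i ∈ (Finset.univ : Finset (Fin t)),
        (noiseLaw μ t).real {w : Fin t → ℝ | ℓ < |w i|} ≤ μ.real {z | ℓ < |z|} := by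
      intro i _
      refine le_of_eq ?_
      have hm : MeasurableSet {z : ℝ | ℓ < |z|} := measurableSet_lt measurable_const measurable_id.abs
      exact congrArg ENNReal.toReal
        ((measurePreserving_eval (fun _ : Fin t => μ) i).measure_preimage hm.nullMeasurableSet)
    refine (Finset.sum_le_sum this).trans ?_
    simp
  · refine (measureReal_biUnion_finset_le _ _).trans ?_
    have hp : μ.real (Set.Ici σ) ^ m ≤ 1 := pow_le_one₀ measureReal_nonneg measureReal_le_one
    have : ∀ s ∈ Finset.range (t + 1),
        (noiseLaw μ t).real {w : Fin t → ℝ | s + L * m ≤ t ∧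
          ∀ l < L, ∃ i < m, extendNoise w (s + l * m + i) < σ} ≤
        (1 - μ.real (Set.Ici σ) ^ m) ^ L := by
      intro s _
      by_cases hs : s + L * m ≤ t
      swap
      · simp only [hs, false_and, Set.ofPred_false, measureReal_empty]
        exact pow_nonneg (by linarith) _
      have hlt : ∀ l : Fin L, ∀ i : Fin m, s + l * m + i < t := by
        intro l i
        have h1 : (l + 1) * m ≤ L * m := Nat.mul_le_mul_right _ l.2
        have h2 : ((l : ℕ) + 1) * m = l * m + m := by ring
        have := i.2
        omega
      let g : Fin L × Fin m → Fin t := fun x => ⟨s + x.1 * m + x.2, hlt x.1 x.2⟩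
      have hg : Function.Injective g := by
        rintro ⟨l, i⟩ ⟨l', i'⟩ h
        have h' : (l : ℕ) * m + i = l' * m + i' := by
          have := congrArg Fin.val h
          simp only [g] at this
          omega
        have hm : 0 < m := i.pos
        have hl : (l : ℕ) = l' := by
          have h1 := congrArg (· / m) h'
          simpa [Nat.mul_comm _ m, Nat.mul_add_div hm, Nat.div_eq_of_lt i.2,
            Nat.div_eq_of_lt i'.2] using h1
        have hi : (i : ℕ) = i' := by rw [hl] at h'; omega
        exact Prod.ext (Fin.ext hl) (Fin.ext hi)
      rw [← pi_real_no_block hg measurableSet_Ici]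
      refine measureReal_mono ?_
      rintro w ⟨-, hw⟩ l
      obtain ⟨i, hi, h⟩ := hw l l.2
      refine ⟨⟨i, hi⟩, ?_⟩
      rw [extendNoise, dif_pos (hlt l ⟨i, hi⟩)] at h
      simpa [g] using h
    refine (Finset.sum_le_sum this).trans ?_
    simp

/-! ### The closed-loop map -/

/-- Truncation of `z` to `[DL, DU]`. -/
noncomputable def truncate (DL DU z : ℝ) : ℝ := max DL (min DU z)

lemma abs_truncate_sub_le (DL DU y z : ℝ) : |truncate DL DU y - truncate DL DU z| ≤ |y - z| :=
  (abs_max_sub_max_le_max _ _ _ _).trans (by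
    simpa using abs_min_sub_min_le_max DU y DU z)

lemma abs_truncate_le {B DL DU : ℝ} (hL : |DL| ≤ B) (hU : |DU| ≤ B) (z : ℝ) :
    |truncate DL DU z| ≤ B := by
  rw [abs_le] at *
  exact ⟨le_max_of_le_left hL.1, max_le hL.2 ((min_le_left _ _).trans hU.2)⟩

lemma continuous_truncate (DL DU : ℝ) : Continuous (truncate DL DU) := by
  unfold truncate; fun_prop

lemma truncatedLinear_eq {DL DU : ℝ} (hD : DL ≤ DU) {θ : ℝ × ℝ} (hb : θ.2 ≠ 0) (K x : ℝ) :
    truncatedLinear DL DU θ K x =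
      (truncate DL DU ((θ.1 - θ.2 * K) * x) - θ.1 * x) / θ.2 := by
  unfold truncatedLinear truncate
  split_ifs with h1 h2
  · rw [min_eq_left h1.le, max_eq_right hD]
  · rw [min_eq_right (h2.le.trans hD), max_eq_left h2.le]
  · rw [min_eq_right (not_lt.1 h1), max_eq_right (not_lt.1 h2)]
    field_simp
    ring

/-- The noiseless closed-loop map `x ↦ β · truncate (c x) + η x`. -/
noncomputable def closedLoop (DL DU β η c x : ℝ) : ℝ := β * truncate DL DU (c * x) + η * x

lemma abs_closedLoop_sub_le {DL DU β η c : ℝ} (hβ : 0 ≤ β) (hc : 0 ≤ c) (x y : ℝ) :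
    |closedLoop DL DU β η c x - closedLoop DL DU β η c y| ≤ (β * c + |η|) * |x - y| := by
  have h := abs_truncate_sub_le DL DU (c * x) (c * y)
  rw [← mul_sub, abs_mul, abs_of_nonneg hc] at h
  calc |closedLoop DL DU β η c x - closedLoop DL DU β η c y|
      = |β * (truncate DL DU (c * x) - truncate DL DU (c * y)) + η * (x - y)| := by
        unfold closedLoop; ring_nf
    _ ≤ β * |truncate DL DU (c * x) - truncate DL DU (c * y)| + |η| * |x - y| := by
        refine (abs_add_le _ _).trans (le_of_eq ?_)
        rw [abs_mul, abs_mul, abs_of_nonneg hβ]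
    _ ≤ β * (c * |x - y|) + |η| * |x - y| := by gcongr
    _ = _ := by ring

/-- Model error appears only as this small perturbation of the ideal map `truncate (c x)`. -/
lemma abs_closedLoop_sub_truncate_le {B DL DU β η c δ : ℝ} (hL : |DL| ≤ B) (hU : |DU| ≤ B)
    (hβ : |β - 1| ≤ δ) (hη : |η| ≤ δ) (x : ℝ) :
    |closedLoop DL DU β η c x - truncate DL DU (c * x)| ≤ δ * (B + |x|) := by
  have hT := abs_truncate_le hL hU (c * x)
  have hδ : 0 ≤ δ := (abs_nonneg _).trans hη
  calc |closedLoop DL DU β η c x - truncate DL DU (c * x)|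
      = |(β - 1) * truncate DL DU (c * x) + η * x| := by unfold closedLoop; ring_nf
    _ ≤ |β - 1| * |truncate DL DU (c * x)| + |η| * |x| := by
        refine (abs_add_le _ _).trans (le_of_eq ?_)
        rw [abs_mul, abs_mul]
    _ ≤ δ * B + δ * |x| := by gcongr
    _ = _ := by ring

/-- Above the upper threshold the closed-loop map is affine with slope `η`. -/
lemma closedLoop_sub_eq_of_lt {DL DU β η c x y : ℝ} (hx : DU < c * x) (hy : DU < c * y) :
    closedLoop DL DU β η c x - closedLoop DL DU β η c y = η * (x - y) := by
  unfold closedLoop truncate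
  rw [min_eq_left hx.le, min_eq_left hy.le]
  ring

/-! ### Coupling of two trajectories -/

/-- If the noise pushes up by at least `σ` for `m` steps and `c` is close enough to `1`, then the
state exceeds the upper threshold, whatever the initial state was. -/
lemma lt_of_push {B DL DU c κ σ : ℝ} (hL : |DL| ≤ B) (hU : |DU| ≤ B) (hσ : 0 < σ) (hc1 : c ≤ 1)
    (hκ : 1 - κ ≤ c) (hκσ : κ * (B + σ) ≤ σ / 4) {m : ℕ} (hm : 2 * B + σ / 2 ≤ m * (σ / 2))
    {X : ℕ → ℝ}
    (hX : ∀ i < m, truncate DL DU (c * X i) + 3 * σ / 4 ≤ X (i + 1)) (hc0 : 0 ≤ c) :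
    DU < c * X m := by
  have hB : 0 ≤ B := (abs_nonneg _).trans hL
  -- Multiplying by `c` costs at most `κ (B + σ) ≤ σ / 4` of the upward push `3σ / 4`.
  have hstep : ∀ i < m, truncate DL DU (c * X i) + σ / 2 ≤ c * X (i + 1) := by
    intro i hi
    have h1 := mul_le_mul_of_nonneg_left (hX i hi) hc0
    have hT := abs_le.1 (abs_truncate_le hL hU (c * X i))
    set z := truncate DL DU (c * X i)
    have h2 : (1 - c) * (z + 3 * σ / 4) ≤ κ * (B + σ) :=
      calc (1 - c) * (z + 3 * σ / 4) ≤ (1 - c) * (B + σ) :=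
            mul_le_mul_of_nonneg_left (by linarith) (by linarith)
        _ ≤ κ * (B + σ) := mul_le_mul_of_nonneg_right (by linarith) (by linarith)
    linarith
  have hz : ∀ i ≤ m, min DU (-B + i * (σ / 2)) ≤ truncate DL DU (c * X i) := by
    intro i
    induction i with
    | zero =>
      intro _
      refine (min_le_right _ _).trans ?_
      simpa using (abs_le.1 (abs_truncate_le hL hU (c * X 0))).1
    | succ i ih =>
      intro hi
      have h1 := ih (by omega)
      have h2 := hstep i (by omega)
      refine le_max_of_le_right (le_min (min_le_left _ _) ?_)
      push_cast
      rcases min_le_iff.1 h1 with h | h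
      · exact (min_le_left _ _).trans (by linarith)
      · exact (min_le_right _ _).trans (by linarith)
  rcases m with _ | m
  -- `m = 0` contradicts `hm`. Otherwise `m - 1` steps saturate the truncation at `DU`, and the last
  -- step gives the strict excess.
  · push_cast at hm; nlinarith
  have h1 := hz m (by omega)
  have h2 := hstep m (by omega)
  have hU' := (abs_le.1 hU).2
  push_cast at hm
  rcases min_le_iff.1 h1 with h | h <;> linarith

/-- Summation of a sequence that at most doubles over `N` steps and halves every `N` steps. -/
lemma sum_range_le_of_halving {N : ℕ} (hN : 0 < N) (n : ℕ) (D : ℕ → ℝ) (h0 : ∀ i, 0 ≤ D i)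
    (hgrow : ∀ s j, j ≤ N → s + j < n → D (s + j) ≤ 2 * D s)
    (hhalf : ∀ s, s + N < n → D (s + N) ≤ D s / 2) :
    ∑ i ∈ Finset.range n, D i ≤ 4 * N * D 0 := by
  induction n using Nat.strong_induction_on generalizing D with
  | _ n ih =>
    have hfirst : ∀ k ≤ N, k ≤ n → ∑ i ∈ Finset.range k, D i ≤ 2 * N * D 0 := by
      intro k hk hkn
      calc ∑ i ∈ Finset.range k, D i ≤ ∑ i ∈ Finset.range k, 2 * D 0 := by
            refine Finset.sum_le_sum fun i hi => ?_
            have := Finset.mem_range.1 hi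
            simpa using hgrow 0 i (by omega) (by omega)
        _ = k * (2 * D 0) := by simp
        _ ≤ N * (2 * D 0) := by
            have : (k : ℝ) ≤ N := by exact_mod_cast hk
            exact mul_le_mul_of_nonneg_right this (by linarith [h0 0])
        _ = _ := by ring
    by_cases hn : n ≤ N
    · have h1 := hfirst n hn le_rfl
      have : 0 ≤ 2 * N * D 0 := by have := h0 0; positivity
      linarith
    · push Not at hn
      have h1 := hfirst N le_rfl hn.le
      have h2 := ih (n - N) (by omega) (fun i => D (N + i)) (fun i => h0 _)
        (fun s j hj hs => by simpa [add_assoc] using hgrow (N + s) j hj (by omega))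
        (fun s hs => by simpa [add_assoc] using hhalf (N + s) (by omega))
      have h3 := hhalf 0 (by omega)
      have hsplit : ∑ i ∈ Finset.range n, D i =
          ∑ i ∈ Finset.range N, D i + ∑ i ∈ Finset.range (n - N), D (N + i) := by
        rw [← Finset.sum_range_add]; congr 2; omega
      rw [hsplit]
      simp only [add_zero, zero_add] at h2 h3
      have h4 : 4 * (N : ℝ) * D N ≤ 4 * N * (D 0 / 2) := by gcongr
      linarith

/-- Summation of a geometrically contracting sequence. -/
lemma sum_range_le_of_contracting {κ : ℝ} (hκ : 0 < κ) (D : ℕ → ℝ) (h0 : ∀ i, 0 ≤ D i)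
    (hD : ∀ i, D (i + 1) ≤ (1 - κ) * D i) (n : ℕ) :
    ∑ i ∈ Finset.range n, D i ≤ 1 / κ * D 0 := by
  have h : κ * ∑ i ∈ Finset.range n, D i + D n ≤ D 0 := by
    induction n with
    | zero => simp
    | succ n ih =>
      rw [Finset.sum_range_succ]
      linarith [hD n]
  rw [one_div, ← div_eq_inv_mul, le_div_iff₀ hκ]
  linarith [h0 n]

/-- The states of a closed loop with noise bounded by `ℓ` stay in `[-R, R]`. -/
lemma abs_le_of_closedLoop {B DL DU β η c δ R ℓ : ℝ} (hL : |DL| ≤ B) (hU : |DU| ≤ B)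
    (hβ : |β - 1| ≤ δ) (hη : |η| ≤ δ) (hR : B + δ * (B + R) + ℓ ≤ R) {u X : ℕ → ℝ}
    (hu : ∀ i, |u i| ≤ ℓ) (hX : ∀ i, X (i + 1) = closedLoop DL DU β η c (X i) + u i)
    (h0 : |X 0| ≤ R) (i : ℕ) : |X i| ≤ R := by
  have hδ : 0 ≤ δ := (abs_nonneg _).trans hη
  induction i with
  | zero => exact h0
  | succ i ih =>
    have h1 := abs_truncate_le hL hU (c * X i)
    have h2 := abs_closedLoop_sub_truncate_le (c := c) hL hU hβ hη (X i)
    have h3 : δ * (B + |X i|) ≤ δ * (B + R) := by gcongr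
    have h4 := hu i
    rw [hX]
    rw [abs_le] at *
    constructor <;> linarith

/-- Two trajectories of the closed loop driven by the same noise stay close in total. -/
lemma sum_abs_sub_le_of_closedLoop {B DL DU β η c δ κ σ R : ℝ} {L m t : ℕ}
    (hL : |DL| ≤ B) (hU : |DU| ≤ B) (hβ : |β - 1| ≤ δ) (hη : |η| ≤ δ) (hδ : δ ≤ 1 / 4)
    (hc0 : 0 ≤ c) (hc1 : c ≤ 1) (hσ : 0 < σ) (hκ : 0 < κ) (hκσ : κ * (B + σ) ≤ σ / 4)
    (hδκ : 4 * δ ≤ κ) (hδσ : δ * (B + R) ≤ σ / 4) (hm : 2 * B + σ / 2 ≤ m * (σ / 2))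
    (hpow : (1 + 2 * δ) ^ (L * m + 1) ≤ 2) {u X Y : ℕ → ℝ}
    (hX : ∀ i, X (i + 1) = closedLoop DL DU β η c (X i) + u i)
    (hY : ∀ i, Y (i + 1) = closedLoop DL DU β η c (Y i) + u i)
    (hXR : ∀ i, |X i| ≤ R) (hYR : ∀ i, |Y i| ≤ R)
    (hu : ∀ s, s + L * m ≤ t → ∃ l < L, ∀ i < m, σ ≤ u (s + l * m + i)) :
    ∑ i ∈ Finset.range (t + 1), |X i - Y i| ≤
      (2 / κ + 4 * (L * m + 1 : ℕ)) * |X 0 - Y 0| := by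
  have hδ0 : 0 ≤ δ := (abs_nonneg _).trans hη
  have hβ' := abs_le.1 hβ
  have hβ0 : 0 ≤ β := by linarith
  have hlip : ∀ i, |X (i + 1) - Y (i + 1)| ≤ (β * c + |η|) * |X i - Y i| := fun i => by
    rw [hX, hY, add_sub_add_right_eq_sub]
    exact abs_closedLoop_sub_le hβ0 hc0 _ _
  by_cases hcκ : c ≤ 1 - κ
  -- Model error adds at most `2δ ≤ κ / 2` to the slope `c ≤ 1 - κ`.
  · have hslope : β * c + |η| ≤ 1 - κ / 2 := by
      have : β * c ≤ (1 + δ) * c := mul_le_mul_of_nonneg_right (by linarith) hc0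
      nlinarith
    have h := sum_range_le_of_contracting (half_pos hκ) (fun i => |X i - Y i|)
      (fun i => abs_nonneg _)
      (fun i => (hlip i).trans (mul_le_mul_of_nonneg_right hslope (abs_nonneg _))) (t + 1)
    refine h.trans (mul_le_mul_of_nonneg_right ?_ (abs_nonneg _))
    rw [one_div_div]
    exact le_add_of_nonneg_right (by positivity)
  · push Not at hcκ
    have hstep : ∀ i, |X (i + 1) - Y (i + 1)| ≤ (1 + 2 * δ) * |X i - Y i| := fun i => by
      refine (hlip i).trans (mul_le_mul_of_nonneg_right ?_ (abs_nonneg _))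
      have : β * c ≤ (1 + δ) * 1 := mul_le_mul (by linarith) hc1 hc0 (by linarith)
      linarith
    have hgrow : ∀ s j, |X (s + j) - Y (s + j)| ≤ (1 + 2 * δ) ^ j * |X s - Y s| := by
      intro s j
      induction j with
      | zero => simp
      | succ j ih =>
        calc |X (s + j + 1) - Y (s + j + 1)| ≤ (1 + 2 * δ) * |X (s + j) - Y (s + j)| := hstep _
          _ ≤ (1 + 2 * δ) * ((1 + 2 * δ) ^ j * |X s - Y s|) := by gcongr
          _ = _ := by ring
    have hone : 1 ≤ 1 + 2 * δ := by linarith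
    have hpush : ∀ Z : ℕ → ℝ, (∀ i, Z (i + 1) = closedLoop DL DU β η c (Z i) + u i) →
        (∀ i, |Z i| ≤ R) → ∀ r, (∀ i < m, σ ≤ u (r + i)) → DU < c * Z (r + m) := by
      intro Z hZ hZR r hr
      -- Of the noise `σ`, at most `δ (B + R) ≤ σ / 4` is lost to model error, leaving `3σ / 4`.
      refine lt_of_push (X := fun i => Z (r + i)) hL hU hσ hc1 hcκ.le hκσ hm (fun i hi => ?_) hc0
      have h1 := (abs_le.1 (abs_closedLoop_sub_truncate_le (c := c) hL hU hβ hη (Z (r + i)))).1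
      have h2 : δ * (B + |Z (r + i)|) ≤ δ * (B + R) := by gcongr; exact hZR _
      have h3 := hr i hi
      have h4 := hZ (r + i)
      rw [add_assoc] at h4
      simp only [h4]
      linarith
    -- The extra `1` is the step after the run, in which the slope `η` acts.
    have h := sum_range_le_of_halving (N := L * m + 1) (by omega) (t + 1)
      (fun i => |X i - Y i|) (fun i => abs_nonneg _)
      (fun s j hj _ => (hgrow s j).trans (mul_le_mul_of_nonneg_right
        ((pow_le_pow_right₀ hone hj).trans hpow) (abs_nonneg _)))
      (fun s hs => by
        obtain ⟨l, hl, hlu⟩ := hu s (by omega)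
        have hlm : l * m + m ≤ L * m := by
          have := Nat.mul_le_mul_right m (show l + 1 ≤ L from hl)
          linarith [add_mul l 1 m]
        obtain ⟨d, hd⟩ := Nat.exists_eq_add_of_le hlm
        have h1 := hgrow s (l * m + m)
        have h2 : |X (s + (l * m + m) + 1) - Y (s + (l * m + m) + 1)| ≤
            δ * |X (s + (l * m + m)) - Y (s + (l * m + m))| := by
          rw [hX, hY, add_sub_add_right_eq_sub, ← add_assoc s,
            closedLoop_sub_eq_of_lt (hpush X hX hXR _ hlu) (hpush Y hY hYR _ hlu), abs_mul]
          gcongr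
        have h3 := hgrow (s + (l * m + m) + 1) d
        have hidx : s + (L * m + 1) = s + (l * m + m) + 1 + d := by omega
        have hpow' : (1 + 2 * δ) ^ d * (1 + 2 * δ) ^ (l * m + m) ≤ 2 := by
          rw [← pow_add]
          exact (pow_le_pow_right₀ hone (by omega)).trans hpow
        rw [hidx]
        -- Growth before and after the run totals at most `2`, while the step with slope `η`
        -- contributes `δ ≤ 1 / 4`.
        calc _ ≤ (1 + 2 * δ) ^ d * (δ * ((1 + 2 * δ) ^ (l * m + m) * |X s - Y s|)) :=
              h3.trans (mul_le_mul_of_nonneg_left (h2.trans (mul_le_mul_of_nonneg_left h1 hδ0))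
                (by positivity))
          _ = δ * |X s - Y s| * ((1 + 2 * δ) ^ d * (1 + 2 * δ) ^ (l * m + m)) := by ring
          _ ≤ δ * |X s - Y s| * 2 := by gcongr
          _ ≤ 1 / 4 * |X s - Y s| * 2 := by gcongr
          _ = |X s - Y s| / 2 := by ring)
    refine h.trans (mul_le_mul_of_nonneg_right ?_ (abs_nonneg _))
    exact le_add_of_nonneg_left (by positivity)

/-! ### From trajectories to costs -/

lemma state_succ (θ : ℝ × ℝ) (C : ℝ → ℝ) {t : ℕ} (x : ℝ) (w : Fin t → ℝ) (i : ℕ) :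
    state θ C x w (i + 1) =
      θ.1 * state θ C x w i + θ.2 * C (state θ C x w i) + extendNoise w i := rfl

lemma continuous_state {θ : ℝ × ℝ} {C : ℝ → ℝ} (hC : Continuous C) {t : ℕ} (x : ℝ) (i : ℕ) :
    Continuous fun w : Fin t → ℝ => state θ C x w i := by
  induction i with
  | zero => exact continuous_const
  | succ i ih =>
    simp only [state_succ]
    have h : Continuous fun w : Fin t → ℝ => extendNoise w i := by
      unfold extendNoise
      split_ifs
      · exact continuous_apply _
      · exact continuous_const
    exact ((continuous_const.mul ih).add (continuous_const.mul (hC.comp ih))).add h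

lemma continuous_avgCost {q r : ℝ} {θ : ℝ × ℝ} {C : ℝ → ℝ} (hC : Continuous C) (t : ℕ) (x : ℝ) :
    Continuous fun w : Fin t → ℝ => avgCost q r θ C t x w := by
  have h := fun i => continuous_state (θ := θ) hC (t := t) x i
  have h' := fun i => hC.comp (h i)
  simp only [Function.comp_def] at h'
  unfold avgCost
  exact continuous_const.mul ((continuous_const.mul ((h t).pow 2)).add
    (continuous_finsetSum _ fun i _ =>
      (continuous_const.mul ((h i).pow 2)).add (continuous_const.mul ((h' i).pow 2))))

lemma abs_sq_sub_sq_le {x y R : ℝ} (hx : |x| ≤ R) (hy : |y| ≤ R) :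
    |x ^ 2 - y ^ 2| ≤ 2 * R * |x - y| := by
  rw [sq_sub_sq, abs_mul]
  have := abs_add_le x y
  exact mul_le_mul_of_nonneg_right (by linarith) (abs_nonneg _)

/-- The total cost is Lipschitz in the trajectory as long as the states stay in `[-R, R]`. -/
lemma abs_mul_avgCost_sub_le {q r Λ R : ℝ} (hq : 0 ≤ q) (hr : 0 ≤ r) (hΛ : 0 ≤ Λ)
    {θ : ℝ × ℝ} {C : ℝ → ℝ} (hC0 : C 0 = 0) (hC : ∀ x y, |C x - C y| ≤ Λ * |x - y|)
    {t : ℕ} {x y : ℝ} {w : Fin t → ℝ}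
    (hx : ∀ i, |state θ C x w i| ≤ R) (hy : ∀ i, |state θ C y w i| ≤ R) :
    |t * avgCost q r θ C t x w - t * avgCost q r θ C t y w| ≤
      (q + r * Λ ^ 2) * (2 * R) *
        ∑ i ∈ Finset.range (t + 1), |state θ C x w i - state θ C y w i| := by
  have hR : 0 ≤ R := (abs_nonneg _).trans (hx 0)
  rcases Nat.eq_zero_or_pos t with rfl | ht
  · simp only [CharP.cast_eq_zero, zero_mul, sub_self, abs_zero]
    have := Finset.sum_nonneg fun i (_ : i ∈ Finset.range (0 + 1)) =>
      abs_nonneg (state θ C x w i - state θ C y w i)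
    positivity
  have ht' : (t : ℝ) ≠ 0 := by positivity
  have hCR : ∀ z, |z| ≤ R → |C z| ≤ Λ * R := fun z hz => by
    have := hC z 0
    rw [hC0, sub_zero, sub_zero] at this
    exact this.trans (mul_le_mul_of_nonneg_left hz hΛ)
  have hqx : ∀ i, |q * state θ C x w i ^ 2 - q * state θ C y w i ^ 2| ≤
      q * (2 * R) * |state θ C x w i - state θ C y w i| := fun i => by
    rw [← mul_sub, abs_mul, abs_of_nonneg hq, mul_assoc]
    exact mul_le_mul_of_nonneg_left (abs_sq_sub_sq_le (hx i) (hy i)) hq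
  have hru : ∀ i, |r * C (state θ C x w i) ^ 2 - r * C (state θ C y w i) ^ 2| ≤
      r * Λ ^ 2 * (2 * R) * |state θ C x w i - state θ C y w i| := fun i => by
    rw [← mul_sub, abs_mul, abs_of_nonneg hr]
    calc _ ≤ r * (2 * (Λ * R) * |C (state θ C x w i) - C (state θ C y w i)|) :=
          mul_le_mul_of_nonneg_left (abs_sq_sub_sq_le (hCR _ (hx i)) (hCR _ (hy i))) hr
      _ ≤ r * (2 * (Λ * R) * (Λ * |state θ C x w i - state θ C y w i|)) := by
          gcongr; exact hC _ _
      _ = _ := by ring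
  unfold avgCost
  rw [← mul_assoc, ← mul_assoc, mul_one_div_cancel ht', one_mul, one_mul, add_sub_add_comm,
    ← Finset.sum_sub_distrib, Finset.sum_range_succ, mul_add, add_comm]
  refine (abs_add_le _ _).trans (add_le_add ?_ ?_)
  · rw [Finset.mul_sum]
    refine (Finset.abs_sum_le_sum_abs _ _).trans (Finset.sum_le_sum fun i _ => ?_)
    rw [add_sub_add_comm]
    refine (abs_add_le _ _).trans ((add_le_add (hqx i) (hru i)).trans (le_of_eq ?_))
    ring
  · refine (hqx t).trans (mul_le_mul_of_nonneg_right ?_ (abs_nonneg _))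
    refine mul_le_mul_of_nonneg_right ?_ (by positivity)
    exact le_add_of_nonneg_right (by positivity)

/-! ### Truncated linear controllers under misspecified parameters -/

lemma closedLoop_eq_of_truncatedLinear {DL DU : ℝ} (hD : DL ≤ DU) {θ : ℝ × ℝ} (hb : θ.2 ≠ 0)
    (θstar : ℝ × ℝ) (K x : ℝ) :
    θstar.1 * x + θstar.2 * truncatedLinear DL DU θ K x =
      closedLoop DL DU (θstar.2 / θ.2) (θstar.1 - θstar.2 / θ.2 * θ.1) (θ.1 - θ.2 * K) x := by
  rw [truncatedLinear_eq hD hb, closedLoop]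
  field_simp
  ring

lemma continuous_truncatedLinear {DL DU : ℝ} (hD : DL ≤ DU) {θ : ℝ × ℝ} (hb : θ.2 ≠ 0) (K : ℝ) :
    Continuous (truncatedLinear DL DU θ K) := by
  rw [funext (truncatedLinear_eq hD hb K)]
  have := continuous_truncate DL DU
  fun_prop

lemma truncatedLinear_zero {DL DU : ℝ} (hL : DL < 0) (hU : 0 < DU) (θ : ℝ × ℝ) (K : ℝ) :
    truncatedLinear DL DU θ K 0 = 0 := by
  simp [truncatedLinear, hL.le, hU.le, not_lt.2]

lemma abs_truncatedLinear_sub_le {DL DU : ℝ} (hD : DL ≤ DU) {θ : ℝ × ℝ} (hb : 0 < θ.2) {K A : ℝ}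
    (hc0 : 0 ≤ θ.1 - θ.2 * K) (hc1 : θ.1 - θ.2 * K ≤ 1) (hA : |θ.1| ≤ A) (x y : ℝ) :
    |truncatedLinear DL DU θ K x - truncatedLinear DL DU θ K y| ≤ (1 + A) / θ.2 * |x - y| := by
  rw [truncatedLinear_eq hD hb.ne', truncatedLinear_eq hD hb.ne', ← sub_div, abs_div,
    abs_of_pos hb, div_mul_eq_mul_div]
  refine div_le_div_of_nonneg_right ?_ hb.le
  have h := abs_truncate_sub_le DL DU ((θ.1 - θ.2 * K) * x) ((θ.1 - θ.2 * K) * y)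
  rw [← mul_sub, abs_mul, abs_of_nonneg hc0] at h
  have h1 : (θ.1 - θ.2 * K) * |x - y| ≤ 1 * |x - y| := by gcongr
  have h2 : |θ.1 * (x - y)| ≤ A * |x - y| := by rw [abs_mul]; gcongr
  rw [abs_le] at *
  constructor <;> linarith

lemma mem_Icc_gain {θ : ℝ × ℝ} (hb : 0 < θ.2) {K : ℝ}
    (hK : K ∈ Set.Icc ((θ.1 - 1) / θ.2) (θ.1 / θ.2)) :
    0 ≤ θ.1 - θ.2 * K ∧ θ.1 - θ.2 * K ≤ 1 := by
  have h1 := (div_le_iff₀ hb).1 hK.1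
  have h2 := (le_div_iff₀ hb).1 hK.2
  constructor <;> linarith

/-- Estimates on parameters near a point of the box `[aLo, aHi] × [bLo, bHi]`. -/
lemma parameter_estimates {aLo aHi bLo bHi ε : ℝ} (haLo : 0 < aLo) (hbLo : 0 < bLo)
    {θ θstar : ℝ × ℝ} (hθstar : θstar ∈ Set.Icc aLo aHi ×ˢ Set.Icc bLo bHi)
    (hθ : ‖θ - θstar‖ ≤ ε) (hε1 : ε ≤ 1) (hεb : ε ≤ bLo / 2) :
    bLo / 2 ≤ θ.2 ∧ |θ.1| ≤ aHi + 1 ∧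
      |θstar.2 / θ.2 - 1| ≤ (1 + 2 * (aHi + 2) / bLo) * ε ∧
      |θstar.1 - θstar.2 / θ.2 * θ.1| ≤ (1 + 2 * (aHi + 2) / bLo) * ε := by
  obtain ⟨⟨ha1, ha2⟩, hb1, hb2⟩ := hθstar
  have hda : |θ.1 - θstar.1| ≤ ε := (norm_fst_le (θ - θstar)).trans hθ
  have hdb : |θ.2 - θstar.2| ≤ ε := (norm_snd_le (θ - θstar)).trans hθ
  have hε0 : 0 ≤ ε := (norm_nonneg _).trans hθ
  have hda' := abs_le.1 hda
  have hdb' := abs_le.1 hdb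
  have hb : bLo / 2 ≤ θ.2 := by linarith
  have hbpos : 0 < θ.2 := by linarith
  have ha : |θ.1| ≤ aHi + 1 := abs_le.2 ⟨by linarith, by linarith⟩
  have hratio : |θstar.2 / θ.2 - 1| ≤ 2 / bLo * ε := by
    have : θstar.2 / θ.2 - 1 = -(θ.2 - θstar.2) / θ.2 := by field_simp; ring
    rw [this, abs_div, abs_neg, abs_of_pos hbpos, div_le_iff₀ hbpos]
    calc |θ.2 - θstar.2| ≤ ε := hdb
      _ = 2 / bLo * ε * (bLo / 2) := by field_simp
      _ ≤ 2 / bLo * ε * θ.2 := by gcongr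
  refine ⟨hb, ha, hratio.trans ?_, ?_⟩
  · refine mul_le_mul_of_nonneg_right ?_ hε0
    have : 2 / bLo ≤ 2 * (aHi + 2) / bLo := by gcongr; linarith
    linarith
  · have heq : θstar.1 - θstar.2 / θ.2 * θ.1 =
        -(θ.1 - θstar.1) - (θstar.2 / θ.2 - 1) * θ.1 := by ring
    have h1 : |(θstar.2 / θ.2 - 1) * θ.1| ≤ 2 / bLo * ε * (aHi + 1) := by
      rw [abs_mul]; gcongr
    have h2 : 2 / bLo * ε * (aHi + 1) ≤ 2 * (aHi + 2) / bLo * ε := by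
      rw [div_mul_eq_mul_div, div_mul_eq_mul_div, div_mul_eq_mul_div]
      gcongr ?_ / _
      nlinarith
    rw [heq]
    refine (abs_sub _ _).trans ?_
    rw [abs_neg]
    linarith

/-- On regular noise the total cost of a truncated linear controller is Lipschitz in the
initial state. -/
lemma abs_mul_avgCost_truncatedLinear_sub_le {q r : ℝ} (hq : 0 ≤ q) (hr : 0 ≤ r)
    {aLo aHi bLo bHi : ℝ} (haLo : 0 < aLo) (haHi : aLo ≤ aHi) (hbLo : 0 < bLo)
    {B DL DU : ℝ} (hDL : DL < 0) (hDU : 0 < DU) (hL : |DL| ≤ B) (hU : |DU| ≤ B)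
    {ε κ σ R ℓ : ℝ} {L m t : ℕ} {θ θstar : ℝ × ℝ}
    (hθstar : θstar ∈ Set.Icc aLo aHi ×ˢ Set.Icc bLo bHi)
    (hθ : ‖θ - θstar‖ ≤ ε) (hε1 : ε ≤ 1) (hεb : ε ≤ bLo / 2)
    {K : ℝ} (hK : K ∈ Set.Icc ((θ.1 - 1) / θ.2) (θ.1 / θ.2))
    {δ : ℝ} (hδ_def : (1 + 2 * (aHi + 2) / bLo) * ε = δ) (hδ : δ ≤ 1 / 4)
    (hσ : 0 < σ) (hκ : 0 < κ) (hκσ : κ * (B + σ) ≤ σ / 4) (hδκ : 4 * δ ≤ κ)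
    (hδσ : δ * (B + R) ≤ σ / 4) (hm : 2 * B + σ / 2 ≤ m * (σ / 2))
    (hpow : (1 + 2 * δ) ^ (L * m + 1) ≤ 2) (hℓ : 0 ≤ ℓ) (hR : B + σ / 4 + ℓ ≤ R)
    {w : Fin t → ℝ} (hw : IsRegularNoise ℓ σ L m w) {x y : ℝ} (hx : |x| ≤ R) (hy : |y| ≤ R) :
    |t * avgCost q r θstar (truncatedLinear DL DU θ K) t x w -
        t * avgCost q r θstar (truncatedLinear DL DU θ K) t y w| ≤
      (q + r * (2 * (aHi + 2) / bLo) ^ 2) * (2 * R) *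
        ((2 / κ + 4 * (L * m + 1 : ℕ)) * |x - y|) := by
  obtain ⟨hb, ha, hβ, hη⟩ := parameter_estimates haLo hbLo hθstar hθ hε1 hεb
  rw [hδ_def] at hβ hη
  have hbpos : 0 < θ.2 := by linarith
  obtain ⟨hc0, hc1⟩ := mem_Icc_gain hbpos hK
  have hD : DL ≤ DU := (hDL.trans hDU).le
  have hR0 : 0 ≤ R := (abs_nonneg x).trans hx
  have hu : ∀ i, |extendNoise w i| ≤ ℓ := fun i => by
    unfold extendNoise
    split_ifs
    · exact hw.1 _
    · simpa using hℓ
  have hdyn : ∀ z i, state θstar (truncatedLinear DL DU θ K) z w (i + 1) =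
      closedLoop DL DU (θstar.2 / θ.2) (θstar.1 - θstar.2 / θ.2 * θ.1) (θ.1 - θ.2 * K)
        (state θstar (truncatedLinear DL DU θ K) z w i) + extendNoise w i := fun z i => by
    rw [state_succ, closedLoop_eq_of_truncatedLinear hD hbpos.ne']
  have hbound : ∀ z, |z| ≤ R → ∀ i, |state θstar (truncatedLinear DL DU θ K) z w i| ≤ R :=
    fun z hz => abs_le_of_closedLoop hL hU hβ hη (by linarith) hu (hdyn z) hz
  have hΛ : 0 ≤ 2 * (aHi + 2) / bLo := by
    have : 0 ≤ aHi + 2 := by linarith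
    positivity
  have hlip : ∀ x y, |truncatedLinear DL DU θ K x - truncatedLinear DL DU θ K y| ≤
      2 * (aHi + 2) / bLo * |x - y| := fun x y => by
    refine (abs_truncatedLinear_sub_le hD hbpos hc0 hc1 ha x y).trans
      (mul_le_mul_of_nonneg_right ?_ (abs_nonneg _))
    rw [div_le_div_iff₀ hbpos hbLo]
    nlinarith
  refine (abs_mul_avgCost_sub_le hq hr hΛ (truncatedLinear_zero hDL hDU θ K) hlip
    (hbound x hx) (hbound y hy)).trans (mul_le_mul_of_nonneg_left ?_ (by positivity))
  exact sum_abs_sub_le_of_closedLoop hL hU hβ hη hδ hc0 hc1 hσ hκ hκσ hδκ hδσ hm hpow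
    (hdyn x) (hdyn y) (hbound x hx) (hbound y hy) hw.2

/-! ### Failure probability and choice of constants -/

lemma isLittleO_div_pow_twelve (c : ℝ) :
    (fun T : ℕ => c / (T : ℝ) ^ 12) =o[atTop] fun T : ℕ => 1 / (T : ℝ) ^ 10 := by
  have h : (fun T : ℕ => c / (T : ℝ) ^ 2) =o[atTop] fun _ => (1 : ℝ) :=
    (isLittleO_one_iff ℝ).2 (tendsto_const_nhds.div_atTop
      ((tendsto_pow_atTop two_ne_zero).comp tendsto_natCast_atTop_atTop))
  refine (h.mul_isBigO (isBigO_refl (fun T : ℕ => 1 / (T : ℝ) ^ 10) atTop)).congr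
    (fun T => ?_) (fun T => ?_)
  · rw [div_mul_div_comm, ← pow_add, mul_one]
  · rw [one_mul]

/-- With `L ≥ A log T` blocks, where `A` is a large constant, the noise is irregular with
probability `O(T⁻¹²)`. -/
lemma noiseLaw_real_not_isRegularNoise_le_div {μ : Measure ℝ} [IsProbabilityMeasure μ]
    {α : NNReal} (hα : HasSubgaussianMGF (fun z : ℝ => z) α μ) {σ : ℝ} {A m : ℕ}
    (hA : (1 - μ.real (Set.Ici σ) ^ m) ^ A ≤ Real.exp (-13)) {t T : ℕ} (ht : t < T) :
    (noiseLaw μ t).real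
        {w | ¬ IsRegularNoise (Real.log T) σ (A * ⌈Real.log T⌉₊) m w} ≤
      (2 * Real.exp (α * 13 ^ 2 / 2) + 1) / (T : ℝ) ^ 12 := by
  have hT : (0 : ℝ) < T := by exact_mod_cast (Nat.zero_le t).trans_lt ht
  -- Rate `13` leaves `T⁻¹²` after union bounds over at most `T` events.
  have hexp : Real.exp (-13 * Real.log T) = 1 / (T : ℝ) ^ 13 := by
    rw [neg_mul, Real.exp_neg, show (13 : ℝ) * Real.log T = (13 : ℕ) * Real.log T by norm_num,
      Real.exp_nat_mul, Real.exp_log hT, one_div]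
  have h1 := HasSubgaussianMGF.real_abs_gt_le hα (s := 13) (by norm_num) (Real.log T)
  have hp : 0 ≤ 1 - μ.real (Set.Ici σ) ^ m := by
    have : μ.real (Set.Ici σ) ^ m ≤ 1 := pow_le_one₀ measureReal_nonneg measureReal_le_one
    linarith
  have h2 : (1 - μ.real (Set.Ici σ) ^ m) ^ (A * ⌈Real.log T⌉₊) ≤ 1 / (T : ℝ) ^ 13 := by
    rw [← hexp, pow_mul]
    refine (pow_le_pow_left₀ (pow_nonneg hp _) hA _).trans ?_
    rw [← Real.exp_nat_mul, Real.exp_le_exp]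
    have := Nat.le_ceil (Real.log T)
    linarith
  rw [hexp] at h1
  have htT : (t : ℝ) + 1 ≤ T := by exact_mod_cast ht
  calc _ ≤ _ := noiseLaw_real_not_isRegularNoise_le _ _ _ _ _
    _ ≤ T * (2 * Real.exp (α * 13 ^ 2 / 2) * (1 / (T : ℝ) ^ 13)) + T * (1 / (T : ℝ) ^ 13) := by
      gcongr
    _ = _ := by field_simp

theorem lemma3 (q r : ℝ) (hq : 0 < q) (hr : 0 < r)
    (μ : Measure ℝ) (hμ : IsNoiseDistribution μ)
    (aLo aHi bLo bHi : ℝ) (haLo : 0 < aLo) (haHi : aLo ≤ aHi) (hbLo : 0 < bLo) (hbHi : bLo ≤ bHi)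
    (B : ℝ) :
    ∃ (k : ℕ) (M : ℝ) (ρ : ℕ → ℝ), ρ =o[atTop] (fun T : ℕ => 1 / (T : ℝ) ^ 10) ∧
      ∀ᶠ T : ℕ in atTop,
        ∀ DL DU : ℝ, IsSafetyBoundary B T DL DU →
        ∀ θstar ∈ Set.Icc aLo aHi ×ˢ Set.Icc bLo bHi,
        -- the noise set, for each `t`, is a function of the controller only
        ∃ Y : (t : ℕ) → (ℝ → ℝ) → Set (Fin t → ℝ),
        ∀ θ : ℝ × ℝ, ‖θ - θstar‖ ≤ 1 / Real.log T ^ 46 →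
        ∀ K ∈ Set.Icc ((θ.1 - 1) / θ.2) (θ.1 / θ.2),
        ∀ t < T,
          MeasurableSet (Y t (truncatedLinear DL DU θ K)) ∧
          1 - ρ T ≤ (noiseLaw μ t).real (Y t (truncatedLinear DL DU θ K)) ∧
          ∀ w ∈ Y t (truncatedLinear DL DU θ K),
          ∀ x y : ℝ, |x| ≤ 4 * Real.log T ^ 2 → |y| ≤ 4 * Real.log T ^ 2 →
            |x - y| ≤ 1 / Real.log T ^ 10 →
            |t * avgCost q r θstar (truncatedLinear DL DU θ K) t x w -
                t * avgCost q r θstar (truncatedLinear DL DU θ K) t y w| ≤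
              M * Real.log T ^ k * (|x - y| + ‖θ - θstar‖) := by
  have hprob := hμ.isProbabilityMeasure
  obtain ⟨α, hα⟩ := hμ.subgaussian
  obtain ⟨σ, hσ, hp⟩ := hμ.exists_pos_real_Ici
  -- Enlarging `B` makes the constants below positive.
  set B' := max B 1 with hB'
  have hB0 : 0 < B' := lt_max_of_lt_right one_pos
  set κ := σ / (4 * (B' + σ)) with hκ_def
  have hκ : 0 < κ := by positivity
  have hκσ : κ * (B' + σ) ≤ σ / 4 := le_of_eq (by rw [hκ_def]; field_simp)
  obtain ⟨m, hm'⟩ := exists_nat_ge ((2 * B' + σ / 2) / (σ / 2))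
  have hm : 2 * B' + σ / 2 ≤ m * (σ / 2) := (div_le_iff₀ (by positivity)).1 hm'
  have hblock1 : 1 - μ.real (Set.Ici σ) ^ m < 1 := by
    have := pow_pos hp m
    linarith
  obtain ⟨A, hA⟩ := exists_pow_lt_of_lt_one (Real.exp_pos (-13)) hblock1
  set c₁ := 1 + 2 * (aHi + 2) / bLo with hc₁
  have haHi2 : 0 < aHi + 2 := by linarith
  have hc₁pos : 1 ≤ c₁ := le_add_of_nonneg_right (by positivity)
  -- Since `⌈ℓ⌉₊ ≤ 2ℓ`, the window length `A ⌈ℓ⌉₊ m + 1` is at most `n ℓ`.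
  set n : ℝ := 2 * A * m + 1 with hn
  have hn1 : 1 ≤ n := le_add_of_nonneg_left (by positivity)
  set G := (q + r * (2 * (aHi + 2) / bLo) ^ 2) with hG
  have hG0 : 0 ≤ G := by positivity
  -- The `8` comes from `2R = 8ℓ²`; the summed distances contribute `(2 / κ + 4n) ℓ`, whence `k =
  -- 3`.
  set M := G * 8 * (2 / κ + 4 * n) with hM
  have hM0 : 0 ≤ M := by positivity
  refine ⟨3, M, fun T => (2 * Real.exp (α * 13 ^ 2 / 2) + 1) / (T : ℝ) ^ 12,
    isLittleO_div_pow_twelve _, ?_⟩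
  have hlog : Tendsto (fun T : ℕ => Real.log T) atTop atTop :=
    Real.tendsto_log_atTop.comp tendsto_natCast_atTop_atTop
  have hsmall : ∀ e : ℝ, 0 < e → ∀ᶠ T : ℕ in atTop, c₁ / Real.log T ≤ e := fun e he =>
    ((tendsto_const_nhds (x := c₁)).div_atTop hlog).eventually (eventually_le_nhds he)
  filter_upwards [hlog.eventually_ge_atTop (B' + σ / 4 + 1), hsmall _ (half_pos hbLo),
    hsmall (1 / 4) (by norm_num), hsmall (κ / 4) (by positivity),
    hsmall (σ / 4 / (B' + 4)) (by positivity), hsmall (1 / 4 / n) (by positivity)]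
    with T hT1 hTb hT4 hTκ hTσ hTn
  intro DL DU hD θstar hθstar
  set ℓ := Real.log T with hℓ_def
  have hℓ1 : 1 ≤ ℓ := by linarith
  have hℓ0 : 0 < ℓ := by linarith
  set ε := 1 / ℓ ^ 46 with hε
  have hε0 : 0 < ε := by positivity
  have hδℓ : c₁ * ε * ℓ ^ 2 ≤ c₁ / ℓ := by
    rw [hε, le_div_iff₀ hℓ0, mul_assoc, mul_assoc]
    refine mul_le_of_le_one_right (by linarith) ?_
    rw [one_div, ← pow_succ, inv_mul_le_iff₀ (by positivity), mul_one]
    exact pow_le_pow_right₀ hℓ1 (by norm_num)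
  have hℓsq : 1 ≤ ℓ ^ 2 := one_le_pow₀ hℓ1
  have hℓle : ℓ ≤ ℓ ^ 2 := by nlinarith
  have hR : B' + σ / 4 + ℓ ≤ 4 * ℓ ^ 2 := by linarith
  have hδ0 : 0 ≤ c₁ * ε := by positivity
  have hδle : c₁ * ε ≤ c₁ / ℓ := (le_mul_of_one_le_right hδ0 hℓsq).trans hδℓ
  have hεδ : ε ≤ c₁ * ε := le_mul_of_one_le_left hε0.le hc₁pos
  have hδσ : c₁ * ε * (B' + 4 * ℓ ^ 2) ≤ σ / 4 :=
    calc c₁ * ε * (B' + 4 * ℓ ^ 2) ≤ c₁ * ε * (B' * ℓ ^ 2 + 4 * ℓ ^ 2) := by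
          gcongr; exact le_mul_of_one_le_right hB0.le hℓsq
      _ = c₁ * ε * ℓ ^ 2 * (B' + 4) := by ring
      _ ≤ σ / 4 / (B' + 4) * (B' + 4) := by gcongr; exact hδℓ.trans hTσ
      _ = σ / 4 := by field_simp
  have hN : ((A * ⌈ℓ⌉₊ * m + 1 : ℕ) : ℝ) ≤ n * ℓ := by
    have hceil : (⌈ℓ⌉₊ : ℝ) ≤ 2 * ℓ := by linarith [(Nat.ceil_lt_add_one hℓ0.le)]
    push_cast
    calc (A : ℝ) * ⌈ℓ⌉₊ * m + 1 ≤ A * (2 * ℓ) * m + ℓ := by gcongr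
      _ = n * ℓ := by rw [hn]; ring
  have hpow : (1 + 2 * (c₁ * ε)) ^ (A * ⌈ℓ⌉₊ * m + 1) ≤ 2 := by
    have hexp : 2 * (c₁ * ε) * (n * ℓ) ≤ 1 / 2 :=
      calc 2 * (c₁ * ε) * (n * ℓ) ≤ 2 * (c₁ * ε) * (n * ℓ ^ 2) := by gcongr
        _ = 2 * n * (c₁ * ε * ℓ ^ 2) := by ring
        _ ≤ 2 * n * (1 / 4 / n) := by gcongr; exact hδℓ.trans hTn
        _ = 1 / 2 := by field_simp; norm_num
    calc (1 + 2 * (c₁ * ε)) ^ (A * ⌈ℓ⌉₊ * m + 1)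
        ≤ Real.exp (2 * (c₁ * ε)) ^ (A * ⌈ℓ⌉₊ * m + 1) := by
          refine pow_le_pow_left₀ (by positivity) ?_ _
          linarith [Real.add_one_le_exp (2 * (c₁ * ε))]
      _ = Real.exp ((A * ⌈ℓ⌉₊ * m + 1 : ℕ) * (2 * (c₁ * ε))) := (Real.exp_nat_mul _ _).symm
      _ ≤ Real.exp (Real.log 2) := by
          refine Real.exp_le_exp.2 ?_
          have : ((A * ⌈ℓ⌉₊ * m + 1 : ℕ) : ℝ) * (2 * (c₁ * ε)) ≤ n * ℓ * (2 * (c₁ * ε)) := by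
            gcongr
          linarith [Real.log_two_gt_d9]
      _ = 2 := Real.exp_log two_pos
  -- Taking the Lipschitz inequality itself as the noise set makes it a function of `C` alone. It is
  -- closed, by continuity of the cost in `w`, and it contains all regular noise.
  refine ⟨fun t C => {w | ∀ x y : ℝ, |x| ≤ 4 * ℓ ^ 2 → |y| ≤ 4 * ℓ ^ 2 →
    |t * avgCost q r θstar C t x w - t * avgCost q r θstar C t y w| ≤ M * ℓ ^ 3 * |x - y|}, ?_⟩
  intro θ hθ K hK t ht
  have hL : |DL| ≤ B' := hD.abs_lower_le.trans (le_max_left _ _)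
  have hU : |DU| ≤ B' := hD.abs_upper_le.trans (le_max_left _ _)
  have hεb : ε ≤ bLo / 2 := hεδ.trans (hδle.trans hTb)
  have hε1 : ε ≤ 1 := by linarith
  have hbpos : 0 < θ.2 :=
    (half_pos hbLo).trans_le (parameter_estimates haLo hbLo hθstar hθ hε1 hεb).1
  have hC : Continuous (truncatedLinear DL DU θ K) :=
    continuous_truncatedLinear (hD.lower_neg.trans hD.upper_pos).le hbpos.ne' K
  have hmeas : MeasurableSet {w : Fin t → ℝ | ∀ x y : ℝ, |x| ≤ 4 * ℓ ^ 2 → |y| ≤ 4 * ℓ ^ 2 →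
      |t * avgCost q r θstar (truncatedLinear DL DU θ K) t x w -
        t * avgCost q r θstar (truncatedLinear DL DU θ K) t y w| ≤ M * ℓ ^ 3 * |x - y|} := by
    refine IsClosed.measurableSet ?_
    simp only [Set.ofPred_forall]
    refine isClosed_iInter fun x => isClosed_iInter fun y => isClosed_iInter fun _ =>
      isClosed_iInter fun _ => isClosed_le ?_ continuous_const
    exact ((continuous_const.mul (continuous_avgCost hC t x)).sub
      (continuous_const.mul (continuous_avgCost hC t y))).abs
  refine ⟨hmeas, ?_, fun w hw x y hx hy _ => (hw x y hx hy).trans ?_⟩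
  · have : IsProbabilityMeasure (noiseLaw μ t) := by unfold noiseLaw; infer_instance
    rw [sub_le_comm, ← probReal_compl_eq_one_sub hmeas]
    refine (measureReal_mono ?_).trans (noiseLaw_real_not_isRegularNoise_le_div hα hA.le ht)
    intro w hw hreg
    refine hw fun x y hx hy => ?_
    refine (abs_mul_avgCost_truncatedLinear_sub_le hq.le hr.le haLo haHi hbLo hD.lower_neg
      hD.upper_pos hL hU hθstar hθ hε1 hεb hK rfl (hδle.trans hT4) hσ hκ hκσ (by linarith) hδσ hm
      hpow hℓ0.le hR hreg hx hy).trans ?_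
    calc G * (2 * (4 * ℓ ^ 2)) * ((2 / κ + 4 * (A * ⌈ℓ⌉₊ * m + 1 : ℕ)) * |x - y|)
        ≤ G * (2 * (4 * ℓ ^ 2)) * ((2 / κ * ℓ + 4 * (n * ℓ)) * |x - y|) := by
          refine mul_le_mul_of_nonneg_left (mul_le_mul_of_nonneg_right (add_le_add ?_ ?_)
            (abs_nonneg _)) (by positivity)
          · exact le_mul_of_one_le_right (by positivity) hℓ1
          · exact mul_le_mul_of_nonneg_left hN (by norm_num)
      _ = M * ℓ ^ 3 * |x - y| := by rw [hM]; ring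
  · exact mul_le_mul_of_nonneg_left (le_add_of_nonneg_right (norm_nonneg _)) (by positivity)
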